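/- Let $\Gamma=(V,E)$ be a connected finite simple graph with $|V|=r+1\ge 3$ and $|E|=n\ge 3$, and let $F_\Gamma=\sum_T\prod_{e\in T}x_e\in\mathbb R[x_e : e\in E]$ be its Kirchhoff polynomial, where $T$ runs over the (edge sets of) spanning trees of $\Gamma$. Let $a\in(\mathbb R_{>0})^n$, let $\partial_a=\sum_{e\in E} a_e\,\partial/\partial x_e$, let $0\le \ell\le r-2$, and put $F=\partial_a^{\ell}F_\Gamma$, a polynomial of degree $d=r-\ell\ge 2$. Write $\nabla F$ (a row vector) and $H_F$ for the gradient and the Hessian matrix of $F$ with respect to the $n$ variables $x_e$. Then: 1. $F$ is strictly homogeneous log-concave at $a$: $F$ is homogeneous of degree $d$ and, for every real $s>\frac{d-1}{d}$, the matrix $\bigl(-F\,H_F+s\,(\nabla F)^T(\nabla F)\bigr)\big|_{x=a}$ is positive definite. 2. $(-1)^{n-1}\,\det H_F\big|_{x=a}>0$. 3. Let $R_F=\mathbb R[x_e : e\in E]/\mathrm{Ann}(F)$, where $\mathrm{Ann}(F)=\{P : P(\partial/\partial x_e : e\in E)\,F=0\}$, and let $R_F^k$ be the image in $R_F$ of the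 homogeneous polynomials of degree $k$. Then the class of $L_a=\sum_{e\in E} a_e x_e$ has the strong Lefschetz property in degree one in $R_F$: the last nonzero graded piece of $R_F$ is $R_F^{d}$, and multiplication by $L_a^{d-2}$ is a bijection $R_F^1\to R_F^{d-1}$. -/

import Mathlib

noncomputable section

namespace Kirchhoff

open MvPolynomial

section Polynomials

variable {σ : Type*}

/-- The Hessian matrix of second partial derivatives of `F`. -/
def hessian (F : MvPolynomial σ ℝ) : Matrix σ σ (MvPolynomial σ ℝ) :=
  Matrix.of fun i j => pderiv i (pderiv j F)

/-- The Hessian matrix of `F` evaluated at the point `a`. -/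
def hessianAt (F : MvPolynomial σ ℝ) (a : σ → ℝ) : Matrix σ σ ℝ :=
  (hessian F).map (eval a)

/-- The gradient of `F` evaluated at the point `a`. -/
def gradAt (F : MvPolynomial σ ℝ) (a : σ → ℝ) : σ → ℝ :=
  fun i => eval a (pderiv i F)

/-- `F` is homogeneous of degree `r` and, for every real `s > (r - 1) / r`, the symmetric matrix
`-F H_F + s (∇F)ᵀ (∇F)` (with `∇F` a row vector) is positive definite at the point `a`. -/
def StrictlyHomogeneousLogConcaveAt (F : MvPolynomial σ ℝ) (r : ℕ) (a : σ → ℝ) : Prop :=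
  F.IsHomogeneous r ∧ ∀ s : ℝ, ((r : ℝ) - 1) / (r : ℝ) < s →
    (-(eval a F • hessianAt F a) + s • Matrix.vecMulVec (gradAt F a) (gradAt F a)).PosDef

/-- The directional derivative `∂_a F = ∑ i, a i * ∂F/∂x_i`. -/
def dirDeriv [Fintype σ] (a : σ → ℝ) (F : MvPolynomial σ ℝ) : MvPolynomial σ ℝ :=
  ∑ i, a i • pderiv i F

/-- The linear form `∑ i, a i * x_i`. -/
def linForm [Fintype σ] (a : σ → ℝ) : MvPolynomial σ ℝ :=
  ∑ i, a i • X i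

/-- The partial derivative `∂/∂x_i` as a linear endomorphism. -/
def pd (i : σ) : Module.End ℝ (MvPolynomial σ ℝ) :=
  (pderiv i : Derivation ℝ (MvPolynomial σ ℝ) (MvPolynomial σ ℝ)).toLinearMap

theorem pd_commute (i j : σ) : Commute (pd i) (pd j) := by
  classical
  have h : ⁅(pderiv i : Derivation ℝ (MvPolynomial σ ℝ) (MvPolynomial σ ℝ)),
      (pderiv j : Derivation ℝ (MvPolynomial σ ℝ) (MvPolynomial σ ℝ))⁆ = 0 := by
    apply MvPolynomial.derivation_ext
    intro k
    rw [Derivation.commutator_apply, pderiv_X, pderiv_X]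
    simp only [Pi.single_apply]
    split_ifs <;> simp
  refine LinearMap.ext fun F => ?_
  have h2 := congrArg (fun D => D F) h
  simpa [Derivation.commutator_apply, sub_eq_zero, pd] using h2

theorem pd_pow_pairwise (m : σ → ℕ) (s : Set σ) :
    s.Pairwise (Function.onFun Commute fun i => pd i ^ m i) :=
  fun i _ j _ _ => (pd_commute i j).pow_pow _ _

/-- The iterated partial derivative `∏ i, (∂/∂x_i) ^ (m i)`. -/
def monomialDiff [Fintype σ] (m : σ →₀ ℕ) : Module.End ℝ (MvPolynomial σ ℝ) :=
  Finset.univ.noncommProd (fun i => pd i ^ m i) (pd_pow_pairwise m _)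

theorem monomialDiff_zero [Fintype σ] : monomialDiff (0 : σ →₀ ℕ) = 1 := by
  rw [monomialDiff, Finset.noncommProd_eq_pow_card _ _ _ 1 (by intro i _; simp), one_pow]

theorem monomialDiff_add [Fintype σ] (m m' : σ →₀ ℕ) :
    monomialDiff (m + m') = monomialDiff m * monomialDiff m' := by
  unfold monomialDiff
  rw [← Finset.noncommProd_mul_distrib _ _ (pd_pow_pairwise m _) (pd_pow_pairwise m' _)
    (fun i _ j _ _ => (pd_commute i j).pow_pow _ _)]
  refine Finset.noncommProd_congr rfl ?_ _
  intro i _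
  simp [pow_add]

/-- The substitution `P ↦ P(∂/∂x_1, …, ∂/∂x_n)`, an algebra homomorphism from polynomials to
constant coefficient differential operators. -/
def diffOp [Fintype σ] : MvPolynomial σ ℝ →ₐ[ℝ] Module.End ℝ (MvPolynomial σ ℝ) :=
  AddMonoidAlgebra.lift ℝ (Module.End ℝ (MvPolynomial σ ℝ)) (σ →₀ ℕ)
    { toFun := fun m => monomialDiff m.toAdd
      map_one' := monomialDiff_zero
      map_mul' := fun m m' => monomialDiff_add m.toAdd m'.toAdd }

theorem diffOp_monomial [Fintype σ] (m : σ →₀ ℕ) (c : ℝ) :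
    diffOp (monomial m c) = c • monomialDiff m := by
  exact (AddMonoidAlgebra.lift_single _ _ _)

/-- `diffOp` sends the variable `x_i` to `∂/∂x_i`. -/
theorem diffOp_X [Fintype σ] (i : σ) (F : MvPolynomial σ ℝ) :
    diffOp (X i) F = pderiv i F := by
  classical
  have h : monomialDiff (Finsupp.single i 1) = pd i := by
    unfold monomialDiff
    rw [← Finset.mul_noncommProd_erase _ (Finset.mem_univ i) _
        (pd_pow_pairwise (Finsupp.single i 1) _) (pd_pow_pairwise (Finsupp.single i 1) _),
      Finset.noncommProd_eq_pow_card _ _ _ 1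
        (fun j hj => by
          rw [Finsupp.single_eq_of_ne (Finset.ne_of_mem_erase hj), pow_zero]), one_pow]
    simp
  rw [X, diffOp_monomial, h, one_smul]
  rfl

/-- The annihilator ideal `{P | P(∂/∂x_1, …, ∂/∂x_n) F = 0}` of `F`. -/
def ann [Fintype σ] (F : MvPolynomial σ ℝ) : Ideal (MvPolynomial σ ℝ) where
  carrier := {P | diffOp P F = 0}
  zero_mem' := by simp
  add_mem' := by
    intro P Q hP hQ
    simp only [Set.mem_ofPred_eq] at hP hQ ⊢
    simp [hP, hQ]
  smul_mem' := by
    intro P Q hQ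
    simp only [Set.mem_ofPred_eq] at hQ ⊢
    simp [hQ]

/-- The algebra `R_F = ℝ[x_1, …, x_n] / Ann(F)`. -/
abbrev annAlgebra [Fintype σ] (F : MvPolynomial σ ℝ) : Type _ :=
  MvPolynomial σ ℝ ⧸ ann F

/-- The degree `k` part of `R_F`: the classes of homogeneous polynomials of degree `k`. -/
def annAlgebraPiece [Fintype σ] (F : MvPolynomial σ ℝ) (k : ℕ) : Submodule ℝ (annAlgebra F) :=
  (homogeneousSubmodule σ ℝ k).map (Ideal.Quotient.mkₐ ℝ (ann F)).toLinearMap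

end Polynomials

/-- Let `A` be a commutative real algebra with graded pieces `A^k = 𝒜 k`. The element `L` is of
degree one, `A^r` is the last nonzero graded piece of `A`, and multiplication by `L ^ (r - 2k)` is
a bijection from `A^k` to `A^(r - k)`, where `2k ≤ r`. -/
structure HasStrongLefschetzAt {A : Type*} [CommRing A] [Algebra ℝ A]
    (𝒜 : ℕ → Submodule ℝ A) (r : ℕ) (L : A) (k : ℕ) : Prop where
  mem_one : L ∈ 𝒜 1
  top_ne_bot : 𝒜 r ≠ ⊥
  above_eq_bot : ∀ i, r < i → 𝒜 i = ⊥
  two_mul_le : 2 * k ≤ r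
  bijOn : Set.BijOn (fun x => L ^ (r - 2 * k) * x) (𝒜 k) (𝒜 (r - k))

section Graphs

variable {V : Type*} [Fintype V] [DecidableEq V] (G : SimpleGraph V) [DecidableRel G.Adj]

/-- A set of edges of `G` is a spanning tree if the graph on all the vertices of `G` having
exactly these edges is a tree. -/
def IsSpanningTree (T : Finset G.edgeSet) : Prop :=
  (SimpleGraph.fromEdgeSet {e : Sym2 V | ∃ t ∈ T, (t : Sym2 V) = e}).IsTree

open Classical in
/-- The Kirchhoff polynomial of `G`, in variables indexed by the edges of `G`: the sum, over all
spanning trees, of the product of the variables of the edges. -/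
def kirchhoffPoly : MvPolynomial G.edgeSet ℝ :=
  ∑ T : Finset G.edgeSet with IsSpanningTree G T, ∏ e ∈ T, X e

end Graphs

end Kirchhoff

end

/-! By the matrix-tree theorem, `F_Γ(x) = det (N diag(x) Nᵀ)` for a reduced incidence matrix `N`.
Put `L = N diag(a) Nᵀ`, `Q = Nᵀ L⁻¹ N` and `f = F_Γ(a)`. Since `F_Γ` is affine in each variable, its
derivatives are unit differences. The determinant lemma then gives gradient `f Qᵢᵢ` and Hessian `f
(Qᵢᵢ Qⱼⱼ - Qᵢⱼ²)` at `a`. For `l = 0` the form in question, at a vector `u`, is therefore `f² (q +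
(s - 1) t²)` with `t = ∑ uᵢ Qᵢᵢ` and `q = ∑ uᵢ uⱼ Qᵢⱼ²`. Writing `L⁻¹ = Cᵀ C` and `S = C N diag(u)
Nᵀ Cᵀ`, one has `t = tr S` and `q = ‖S‖²` (Frobenius norm). Cauchy–Schwarz gives `t² ≤ r q`, and `q
> 0` for `u ≠ 0` because the edge Laplacians of a simple graph are independent (`transfer_sq_sum`).
Passing to `∂_a^l` costs only constants: by Euler's identity the value, gradient and Hessian at `a`
are multiplied by falling factorials. The other two claims are formal. The case `s = 1` is a rank
one perturbation of `-F H_F`, which fixes the sign of the determinant. Moreover, `L_a^(d-2) p` sends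
`F` to a linear form with coefficients `(d-2)! H_F(a) p`, so invertibility of the Hessian is the
Lefschetz property. -/

namespace Matrix

/-! ### Cauchy–Binet for weighted Gram matrices. -/

variable {m n R : Type*} [Fintype m] [DecidableEq m] [Fintype n] [DecidableEq n] [CommRing R]

/-- The matrix `N diag(x) Nᵀ`. -/
def weightedGram (N : Matrix m n R) (x : n → R) : Matrix m m R :=
  N * diagonal x * Nᵀ

omit [Fintype m] [DecidableEq m] in
theorem weightedGram_apply (N : Matrix m n R) (x : n → R) (i j : m) :
    weightedGram N x i j = ∑ e, x e * (N i e * N j e) := by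
  rw [weightedGram, mul_apply]
  exact Finset.sum_congr rfl fun e _ => by rw [mul_diagonal, transpose_apply]; ring

/-- Each row is a combination of the columns of `N`; multilinearity expands the determinant over the
choices `p` of one column per row. -/
theorem det_weightedGram (N : Matrix m n R) (x : n → R) :
    (weightedGram N x).det =
      ∑ p : m → n, (∏ i, x (p i)) * ((∏ i, N i (p i)) * (Nᵀ.submatrix p id).det) := by
  have hrow : weightedGram N x = fun i => ∑ e, (x e * N i e) • Nᵀ e := by
    ext i j
    simp [weightedGram_apply, Finset.sum_apply, mul_assoc]
  rw [hrow]
  change detRowAlternating (fun i => ∑ e, (x e * N i e) • Nᵀ e) = _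
  rw [← AlternatingMap.coe_multilinearMap, MultilinearMap.map_sum]
  refine Finset.sum_congr rfl fun p _ => ?_
  rw [MultilinearMap.map_smul_univ, Finset.prod_mul_distrib, smul_eq_mul, mul_assoc]
  rfl

/-- A form of the Cauchy–Binet formula: the determinant of `N diag(x) Nᵀ` is the generating
polynomial of the Gram determinants of its maximal sets of columns. -/
theorem det_weightedGram_eq_sum_powersetCard (N : Matrix m n R) (x : n → R) :
    (weightedGram N x).det =
      ∑ T ∈ Finset.univ.powersetCard (Fintype.card m),
        (∏ e ∈ T, x e) * (weightedGram N fun e => if e ∈ T then 1 else 0).det := by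
  simp_rw [det_weightedGram, Finset.mul_sum]
  rw [Finset.sum_comm]
  refine Finset.sum_congr rfl fun p _ => ?_
  -- An injective `p` contributes only to `T = image p`; any other `p` repeats a row and contributes
  -- nothing.
  by_cases hp : Function.Injective p
  · have hcard : (Finset.univ.image p).card = Fintype.card m := by
      rw [Finset.card_image_of_injective _ hp, Finset.card_univ]
    rw [Finset.sum_eq_single (Finset.univ.image p)]
    · rw [Finset.prod_image fun a _ b _ h => hp h]
      simp
    · intro T hT hne
      have : ∃ i, p i ∉ T := by
        by_contra! h
        refine hne (Finset.eq_of_subset_of_card_le ?_ ?_).symm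
        · exact Finset.image_subset_iff.2 fun i _ => h i
        · rw [hcard, (Finset.mem_powersetCard.1 hT).2]
      obtain ⟨i, hi⟩ := this
      rw [Finset.prod_eq_zero (Finset.mem_univ i) (by simp [hi])]
      simp
    · intro h
      exact absurd (Finset.mem_powersetCard.2 ⟨Finset.subset_univ _, hcard⟩) h
  · obtain ⟨i, j, hij, hne⟩ : ∃ i j, p i = p j ∧ i ≠ j := by
      simpa [Function.Injective] using hp
    have h0 : (Nᵀ.submatrix p id).det = 0 :=
      det_zero_of_row_eq hne (by ext k; simp [hij])
    simp [h0]

end Matrix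

noncomputable section

namespace Kirchhoff

open MvPolynomial Matrix

/-! ### Incidence matrices and the matrix-tree theorem. -/

section Graphs

variable {V : Type*} [Fintype V] [DecidableEq V] (G : SimpleGraph V) [DecidableRel G.Adj] (v₀ : V)

/-- The indicator of the vertex `u`, restricted to the vertices different from `v₀`. -/
def vertexVec (u : V) : {v : V // v ≠ v₀} → ℤ := fun v => if (v : V) = u then 1 else 0

/-- The vertex-edge incidence matrix of an orientation of `G`, without the row of `v₀`. -/
def incidence : Matrix {v : V // v ≠ v₀} G.edgeSet ℤ :=
  Matrix.of fun v e =>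
    (vertexVec v₀ (Quot.out (e : Sym2 V)).1 - vertexVec v₀ (Quot.out (e : Sym2 V)).2) v

omit [Fintype V] in
theorem vertexVec_self : vertexVec v₀ v₀ = 0 := by
  ext v; simp [vertexVec, v.2]

omit [Fintype V] in
theorem vertexVec_coe (w : {v : V // v ≠ v₀}) : vertexVec v₀ w = Pi.single w 1 := by
  ext v; simp [vertexVec, Pi.single_apply, Subtype.ext_iff]

omit [Fintype V] [DecidableRel G.Adj] in
-- The orientation chosen by `Quot.out` matters only up to sign, and signs cancel in `N diag(x) Nᵀ`.
theorem incidence_col (e : G.edgeSet) {u v : V} (h : (e : Sym2 V) = s(u, v)) :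
    (incidence G v₀)ᵀ e = vertexVec v₀ u - vertexVec v₀ v ∨
      (incidence G v₀)ᵀ e = -(vertexVec v₀ u - vertexVec v₀ v) := by
  have h1 : s((Quot.out (e : Sym2 V)).1, (Quot.out (e : Sym2 V)).2) = s(u, v) := by
    rw [← h]; exact Quot.out_eq (e : Sym2 V)
  rw [Sym2.eq_iff] at h1
  rcases h1 with ⟨h1, h2⟩ | ⟨h1, h2⟩
  · left; ext w; simp [incidence, h1, h2]
  · right; ext w; simp [incidence, h1, h2]

/-- The graph on all the vertices whose edges are those in `T`. -/
def edgeSubgraph {G : SimpleGraph V} (T : Finset G.edgeSet) : SimpleGraph V :=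
  SimpleGraph.fromEdgeSet {e : Sym2 V | ∃ t ∈ T, (t : Sym2 V) = e}

variable {G}

omit [Fintype V] [DecidableEq V] [DecidableRel G.Adj] in
theorem edgeSet_edgeSubgraph (T : Finset G.edgeSet) :
    (edgeSubgraph T).edgeSet = (↑) '' (T : Set G.edgeSet) := by
  rw [edgeSubgraph, SimpleGraph.edgeSet_fromEdgeSet, sdiff_eq_left.2]
  · ext; simp
  · rw [Set.disjoint_left]
    rintro _ ⟨t, -, rfl⟩
    exact G.not_isDiag_of_mem_edgeSet t.2

omit [Fintype V] [DecidableEq V] [DecidableRel G.Adj] in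
theorem ncard_edgeSet_edgeSubgraph (T : Finset G.edgeSet) :
    Nat.card (edgeSubgraph T).edgeSet = T.card := by
  rw [edgeSet_edgeSubgraph, Nat.card_image_of_injective Subtype.val_injective]
  simp

omit [DecidableEq V] [DecidableRel G.Adj] in
theorem card_of_isSpanningTree {T : Finset G.edgeSet} (h : IsSpanningTree G T) :
    T.card + 1 = Fintype.card V := by
  have := (SimpleGraph.isTree_iff_connected_and_card.1 h).2
  rw [← Nat.card_eq_fintype_card, ← this]
  exact congrArg (· + 1) (ncard_edgeSet_edgeSubgraph T).symm

omit [DecidableEq V] [DecidableRel G.Adj] in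
theorem isSpanningTree_of_connected {T : Finset G.edgeSet} (h : (edgeSubgraph T).Connected)
    (hT : T.card + 1 = Fintype.card V) : IsSpanningTree G T := by
  refine SimpleGraph.isTree_iff_connected_and_card.2 ⟨h, ?_⟩
  rw [Nat.card_eq_fintype_card (α := V), ← hT]
  exact congrArg (· + 1) (ncard_edgeSet_edgeSubgraph T)

omit [Fintype V] [DecidableEq V] [DecidableRel G.Adj] in
theorem exists_of_adj_edgeSubgraph {T : Finset G.edgeSet} {u v : V}
    (h : (edgeSubgraph T).Adj u v) : ∃ e ∈ T, (e : Sym2 V) = s(u, v) := by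
  rw [edgeSubgraph, SimpleGraph.fromEdgeSet_adj] at h
  exact h.1

omit [Fintype V] [DecidableRel G.Adj] in
-- Telescoping along a walk from `u` to `v`.
theorem vertexVec_sub_mem_span {T : Finset G.edgeSet} {u v : V}
    (h : (edgeSubgraph T).Reachable u v) :
    vertexVec v₀ u - vertexVec v₀ v ∈ Submodule.span ℤ ((incidence G v₀)ᵀ '' T) := by
  obtain ⟨p⟩ := h
  induction p with
  | nil => simp
  | @cons u w v hadj p ih =>
    obtain ⟨e, he, huw⟩ := exists_of_adj_edgeSubgraph hadj
    have hmem := Submodule.subset_span (R := ℤ) (Set.mem_image_of_mem (incidence G v₀)ᵀ he)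
    rw [← sub_add_sub_cancel _ (vertexVec v₀ w)]
    refine add_mem ?_ ih
    rcases incidence_col G v₀ e huw with h | h
    · rwa [h] at hmem
    · rw [h] at hmem
      exact neg_mem_iff.1 hmem

/-- Paths to `v₀` show that the columns in `T` span the integer lattice. They form a square matrix,
so its determinant is a unit of `ℤ`, whose square is 1; this is why the incidence matrix is taken
over `ℤ`. -/
theorem det_incidence_of_isSpanningTree {T : Finset G.edgeSet} (h : IsSpanningTree G T) :
    (weightedGram (incidence G v₀) fun e => if e ∈ T then 1 else 0).det = 1 := by
  have hcard : Fintype.card {v : V // v ≠ v₀} = Fintype.card T := by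
    have := card_of_isSpanningTree h
    rw [Fintype.card_subtype_compl, Fintype.card_coe, Fintype.card_subtype_eq]
    omega
  let ε := Fintype.equivOfCardEq hcard
  let N' : Matrix {v : V // v ≠ v₀} {v : V // v ≠ v₀} ℤ :=
    (incidence G v₀).submatrix id fun w => (ε w : G.edgeSet)
  have hprod : (weightedGram (incidence G v₀) fun e => if e ∈ T then 1 else 0) =
      N' * N'ᵀ := by
    ext i j
    simp only [weightedGram_apply, mul_apply, transpose_apply, N', submatrix_apply, id]
    rw [Equiv.sum_comp ε fun t : T => incidence G v₀ i t * incidence G v₀ j t,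
      Finset.sum_coe_sort T fun t => incidence G v₀ i t * incidence G v₀ j t]
    simp [Finset.sum_ite_mem]
  have hsurj : Function.Surjective N'.mulVec := by
    have : LinearMap.range N'.mulVecLin = ⊤ := by
      rw [range_mulVecLin]
      have hr : Set.range N'.col = (incidence G v₀)ᵀ '' T := by
        ext c
        constructor
        · rintro ⟨w, rfl⟩
          exact ⟨ε w, (ε w).2, rfl⟩
        · rintro ⟨t, ht, rfl⟩
          exact ⟨ε.symm ⟨t, ht⟩, by ext v; simp [N', col]⟩
      rw [hr, eq_top_iff, ← (Pi.basisFun ℤ {v : V // v ≠ v₀}).span_eq, Submodule.span_le]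
      rintro _ ⟨w, rfl⟩
      have := vertexVec_sub_mem_span v₀ (T := T) (h.connected.preconnected w v₀)
      rw [vertexVec_self, sub_zero, vertexVec_coe] at this
      simpa using this
    exact LinearMap.range_eq_top.1 this
  have hu := (isUnit_iff_isUnit_det _).1 (mulVec_surjective_iff_isUnit.1 hsurj)
  rw [hprod, det_mul, det_transpose]
  exact Int.isUnit_mul_self hu

/-- With the right number of edges, failing to be a tree means being disconnected. The indicator `y`
of the vertices not joined to `v₀` is constant along edges of `T`, hence a nonzero left kernel
vector. -/
theorem det_incidence_of_not_isSpanningTree {T : Finset G.edgeSet} (h : ¬ IsSpanningTree G T)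
    (hT : T.card + 1 = Fintype.card V) :
    (weightedGram (incidence G v₀) fun e => if e ∈ T then 1 else 0).det = 0 := by
  classical
  have hnc : ¬ (edgeSubgraph T).Connected := fun hc => h (isSpanningTree_of_connected hc hT)
  obtain ⟨u, hu⟩ : ∃ u, ¬ (edgeSubgraph T).Reachable u v₀ := by
    by_contra! hr
    exact hnc ((SimpleGraph.connected_iff _).2 ⟨fun a b => (hr a).trans (hr b).symm, ⟨v₀⟩⟩)
  let y : V → ℤ := fun w => if (edgeSubgraph T).Reachable w v₀ then 0 else 1
  have hy0 : y v₀ = 0 := by simp [y]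
  have hsum (w : V) : (fun v : {v : V // v ≠ v₀} => y v) ⬝ᵥ vertexVec v₀ w = y w := by
    by_cases hw : w = v₀
    · rw [hw, vertexVec_self, hy0, dotProduct_zero]
    · rw [show w = ((⟨w, hw⟩ : {v : V // v ≠ v₀}) : V) from rfl, vertexVec_coe]
      simp
  refine exists_vecMul_eq_zero_iff.1 ⟨fun v => y v, ?_, ?_⟩
  · intro h0
    have hne : u ≠ v₀ := fun h => hu (h ▸ SimpleGraph.Reachable.refl _)
    have := congrFun h0 ⟨u, hne⟩
    simp [y, hu] at this
  · rw [weightedGram, ← vecMul_vecMul, ← vecMul_vecMul]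
    suffices h0 : ((fun v : {v : V // v ≠ v₀} => y v) ᵥ* incidence G v₀) ᵥ*
        diagonal (fun e => if e ∈ T then (1 : ℤ) else 0) = 0 by
      rw [h0, zero_vecMul]
    ext e
    rw [vecMul_diagonal]
    by_cases he : e ∈ T
    · have hadj : (edgeSubgraph T).Reachable (Quot.out (e : Sym2 V)).1 (Quot.out (e : Sym2 V)).2 := by
        have hs : s((Quot.out (e : Sym2 V)).1, (Quot.out (e : Sym2 V)).2) = e :=
          Quot.out_eq (e : Sym2 V)
        refine SimpleGraph.Adj.reachable ?_
        rw [← SimpleGraph.mem_edgeSet, edgeSet_edgeSubgraph, hs]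
        exact ⟨e, he, rfl⟩
      have hyy : y (Quot.out (e : Sym2 V)).1 = y (Quot.out (e : Sym2 V)).2 := by
        have : (edgeSubgraph T).Reachable (Quot.out (e : Sym2 V)).1 v₀ ↔
            (edgeSubgraph T).Reachable (Quot.out (e : Sym2 V)).2 v₀ :=
          ⟨hadj.symm.trans, hadj.trans⟩
        simp [y, this]
      have : ((fun v : {v : V // v ≠ v₀} => y v) ᵥ* incidence G v₀) e = 0 := by
        change (fun v : {v : V // v ≠ v₀} => y v) ⬝ᵥ (vertexVec v₀ _ - vertexVec v₀ _) = 0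
        rw [dotProduct_sub, hsum, hsum, hyy, sub_self]
      simp [this]
    · simp [he]

variable (G)

/-- The incidence matrix with real entries. -/
def realIncidence : Matrix {v : V // v ≠ v₀} G.edgeSet ℝ :=
  (incidence G v₀).map (Int.cast : ℤ → ℝ)

/-- The **matrix-tree theorem**: the weighted reduced Laplacian has the Kirchhoff polynomial as
its determinant. -/
theorem eval_kirchhoffPoly (x : G.edgeSet → ℝ) :
    eval x (kirchhoffPoly G) =
      (weightedGram (realIncidence G v₀) x).det := by
  classical
  rw [det_weightedGram_eq_sum_powersetCard, kirchhoffPoly, map_sum]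
  have hV : 0 < Fintype.card V := Fintype.card_pos_iff.2 ⟨v₀⟩
  have hc : Fintype.card {v : V // v ≠ v₀} + 1 = Fintype.card V := by
    rw [Fintype.card_subtype_compl, Fintype.card_subtype_eq]; omega
  have hdet (T : Finset G.edgeSet) : (weightedGram (realIncidence G v₀) fun e => if e ∈ T then 1 else 0).det =
      ((weightedGram (incidence G v₀) fun e => if e ∈ T then 1 else 0).det : ℤ) := by
    rw [Int.cast_det]
    congr 1
    ext i j
    simp [realIncidence, weightedGram_apply]
  have hsub : ({T | IsSpanningTree G T} : Finset (Finset G.edgeSet)) ⊆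
      Finset.univ.powersetCard (Fintype.card {v : V // v ≠ v₀}) := by
    intro T hT
    have := card_of_isSpanningTree (Finset.mem_filter.1 hT).2
    exact Finset.mem_powersetCard.2 ⟨Finset.subset_univ _, by omega⟩
  rw [← Finset.sum_subset hsub]
  · refine Finset.sum_congr rfl fun T hT => ?_
    rw [hdet, det_incidence_of_isSpanningTree v₀ (Finset.mem_filter.1 hT).2]
    simp
  · intro T hT hn
    have : ¬ IsSpanningTree G T := fun h => hn (Finset.mem_filter.2 ⟨Finset.mem_univ _, h⟩)
    rw [hdet, det_incidence_of_not_isSpanningTree v₀ this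
      (by rw [(Finset.mem_powersetCard.1 hT).2, hc])]
    simp

variable {G}

omit [DecidableEq V] in
theorem exists_isSpanningTree (h : G.Connected) : ∃ T, IsSpanningTree G T := by
  classical
  obtain ⟨H, hle, hH⟩ := h.exists_isTree_le
  refine ⟨Finset.univ.filter fun e => (e : Sym2 V) ∈ H.edgeSet, ?_⟩
  rw [IsSpanningTree]
  convert hH
  conv_rhs => rw [← H.fromEdgeSet_edgeSet]
  congr 1
  ext e
  simp only [Finset.mem_filter, Finset.mem_univ, true_and, Set.mem_ofPred_eq]
  constructor
  · rintro ⟨t, ht, rfl⟩; exact ht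
  · intro he; exact ⟨⟨e, SimpleGraph.edgeSet_mono hle he⟩, he, rfl⟩

omit [DecidableEq V] in
theorem eval_kirchhoffPoly_pos (h : G.Connected) {a : G.edgeSet → ℝ} (ha : ∀ e, 0 < a e) :
    0 < eval a (kirchhoffPoly G) := by
  classical
  rw [kirchhoffPoly, map_sum]
  obtain ⟨T, hT⟩ := exists_isSpanningTree h
  refine Finset.sum_pos (fun T _ => ?_) ⟨T, Finset.mem_filter.2 ⟨Finset.mem_univ _, hT⟩⟩
  rw [map_prod]
  exact Finset.prod_pos fun e _ => by simpa using ha e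

omit [DecidableEq V] in
theorem isHomogeneous_kirchhoffPoly {r : ℕ} (hV : Fintype.card V = r + 1) :
    (kirchhoffPoly G).IsHomogeneous r := by
  classical
  refine IsHomogeneous.sum _ _ _ fun T hT => ?_
  have hc : T.card = r := by
    have := card_of_isSpanningTree (Finset.mem_filter.1 hT).2
    omega
  rw [← hc, Finset.card_eq_sum_ones]
  exact IsHomogeneous.prod _ _ _ fun e _ => isHomogeneous_X ℝ e

omit [Fintype V] [DecidableRel G.Adj] in
theorem incidence_ne_zero_iff (p : {v : V // v ≠ v₀}) (e : G.edgeSet) :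
    realIncidence G v₀ p e ≠ 0 ↔ (p : V) ∈ (e : Sym2 V) := by
  obtain ⟨u, v, huv⟩ : ∃ u v, (e : Sym2 V) = s(u, v) := by
    induction h : (e : Sym2 V) using Sym2.ind with
    | _ u v => exact ⟨u, v, rfl⟩
  have hne : u ≠ v := by
    have := G.ne_of_adj (a := u) (b := v) (by rw [← SimpleGraph.mem_edgeSet, ← huv]; exact e.2)
    exact this
  rw [realIncidence, map_apply, Int.cast_ne_zero, huv, Sym2.mem_iff]
  rcases incidence_col G v₀ e huv with h | h <;>
  · have h := congrFun h p
    rw [transpose_apply] at h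
    rw [h]
    by_cases h1 : (p : V) = u
    · simp [vertexVec, h1, hne]
    · simp [vertexVec, h1]

/-- In a simple graph, the rank one Laplacians of the single edges are linearly independent. -/
theorem eq_zero_of_weightedGram_eq_zero (u : G.edgeSet → ℝ)
    (h : weightedGram (realIncidence G v₀) u = 0) : u = 0 := by
  -- Only edges containing both `p` and `q` enter the entry `(p, q)`; if all but `e` have weight
  -- zero, the entry determines `u e`.
  have key (p q : {v : V // v ≠ v₀}) (e : G.edgeSet) (hp : (p : V) ∈ (e : Sym2 V))
      (hq : (q : V) ∈ (e : Sym2 V))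
      (huniq : ∀ e' : G.edgeSet, (p : V) ∈ (e' : Sym2 V) → (q : V) ∈ (e' : Sym2 V) → e' ≠ e →
        u e' = 0) : u e = 0 := by
    have hpq := congrFun (congrFun h p) q
    rw [weightedGram_apply, Finset.sum_eq_single e] at hpq
    · have h1 := (incidence_ne_zero_iff v₀ p e).2 hp
      have h2 := (incidence_ne_zero_iff v₀ q e).2 hq
      simpa [h1, h2] using hpq
    · intro e' _ hne
      by_contra h0
      simp only [mul_eq_zero, not_or] at h0
      exact h0.1 (huniq e' ((incidence_ne_zero_iff v₀ p e').1 h0.2.1)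
        ((incidence_ne_zero_iff v₀ q e').1 h0.2.2) hne)
    · simp
  have hmem (e : G.edgeSet) : ∃ x y, x ≠ y ∧ (e : Sym2 V) = s(x, y) := by
    obtain ⟨e, he⟩ := e
    induction e using Sym2.ind with
    | _ x y => exact ⟨x, y, G.ne_of_adj he, rfl⟩
  -- Simplicity enters here: the off-diagonal entry `(x, y)` sees a single edge.
  have hoff (e : G.edgeSet) (he : v₀ ∉ (e : Sym2 V)) : u e = 0 := by
    obtain ⟨x, y, hxy, hexy⟩ := hmem e
    rw [hexy, Sym2.mem_iff, not_or] at he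
    refine key ⟨x, Ne.symm he.1⟩ ⟨y, Ne.symm he.2⟩ e (by simp [hexy]) (by simp [hexy]) ?_
    intro e' hx hy hne
    exact absurd (Subtype.ext (((Sym2.mem_and_mem_iff hxy).1 ⟨hx, hy⟩).trans hexy.symm)) hne
  -- Once the edges avoiding `v₀` are gone, the diagonal entry at `x` sees only the edge to `v₀`.
  have hon (x : V) (hx : x ≠ v₀) (e : G.edgeSet) (he : (e : Sym2 V) = s(x, v₀)) : u e = 0 := by
    refine key ⟨x, hx⟩ ⟨x, hx⟩ e (by simp [he]) (by simp [he]) ?_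
    intro e' hx' _ hne
    refine hoff e' fun h0 => hne (Subtype.ext ?_)
    exact ((Sym2.mem_and_mem_iff hx).1 ⟨hx', h0⟩).trans he.symm
  ext e
  by_cases he : v₀ ∈ (e : Sym2 V)
  · obtain ⟨x, y, hxy, hexy⟩ := hmem e
    rw [hexy, Sym2.mem_iff] at he
    rcases he with rfl | rfl
    · exact hon y hxy.symm e (hexy.trans Sym2.eq_swap)
    · exact hon x hxy e hexy
  · exact hoff e he

end Graphs

end Kirchhoff

/-! ### Rank one perturbations and the trace inequality. -/

namespace Matrix

variable {m n : Type*} [Fintype m] [DecidableEq m] [Fintype n] [DecidableEq n]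

omit [DecidableEq m] in
theorem weightedGram_mul_left {R : Type*} [CommRing R] (C : Matrix m m R) (N : Matrix m n R)
    (x : n → R) : weightedGram (C * N) x = C * weightedGram N x * Cᵀ := by
  simp only [weightedGram, transpose_mul, Matrix.mul_assoc]

/-- The effect of rank one perturbations on the determinant of `N diag(x) Nᵀ`. -/
theorem det_weightedGram_add_single {ι : Type*} [Fintype ι] [DecidableEq ι] (N : Matrix m n ℝ)
    (x : n → ℝ) (hx : IsUnit (weightedGram N x).det) (p : ι → n) :
    (weightedGram N (x + ∑ k, Pi.single (p k) 1)).det =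
      (weightedGram N x).det *
        (1 + (Nᵀ * (weightedGram N x)⁻¹ * N).submatrix p p).det := by
  have h : weightedGram N (x + ∑ k, Pi.single (p k) 1) =
      weightedGram N x + N.submatrix id p * (N.submatrix id p)ᵀ := by
    ext i j
    simp only [weightedGram_apply, add_apply, mul_apply, Pi.add_apply, Finset.sum_apply, add_mul,
      Finset.sum_add_distrib, Finset.sum_mul, submatrix_apply, transpose_apply, id]
    rw [Finset.sum_comm (s := Finset.univ (α := n))]
    simp [Pi.single_apply]
  rw [h, det_add_mul _ _ hx]
  rfl

theorem det_weightedGram_add_single_one (N : Matrix m n ℝ) (x : n → ℝ)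
    (hx : IsUnit (weightedGram N x).det) (i : n) :
    (weightedGram N (x + Pi.single i 1)).det =
      (weightedGram N x).det * (1 + (Nᵀ * (weightedGram N x)⁻¹ * N) i i) := by
  have h := det_weightedGram_add_single N x hx ![i]
  rw [det_fin_one, add_apply, submatrix_apply] at h
  simpa using h

theorem det_weightedGram_add_single_two (N : Matrix m n ℝ) (x : n → ℝ)
    (hx : (weightedGram N x).PosDef) (i j : n) :
    (weightedGram N (x + Pi.single i 1 + Pi.single j 1)).det =
      (weightedGram N x).det *
        ((1 + (Nᵀ * (weightedGram N x)⁻¹ * N) i i) * (1 + (Nᵀ * (weightedGram N x)⁻¹ * N) j j) -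
          (Nᵀ * (weightedGram N x)⁻¹ * N) i j ^ 2) := by
  have hsymm : (Nᵀ * (weightedGram N x)⁻¹ * N) j i = (Nᵀ * (weightedGram N x)⁻¹ * N) i j := by
    have : (Nᵀ * (weightedGram N x)⁻¹ * N)ᵀ = Nᵀ * (weightedGram N x)⁻¹ * N := by
      have := hx.inv.isHermitian.eq
      rw [conjTranspose_eq_transpose_of_trivial] at this
      rw [transpose_mul, transpose_mul, this, transpose_transpose, Matrix.mul_assoc]
    exact congrFun (congrFun this i) j
  have h := det_weightedGram_add_single N x hx.det_pos.ne'.isUnit ![i, j]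
  rw [det_fin_two] at h
  simp only [Fin.sum_univ_two, ← add_assoc, add_apply, submatrix_apply, cons_val_zero,
    cons_val_one, one_apply_eq, hsymm] at h
  rw [h, one_apply_ne (by decide), one_apply_ne (by decide)]
  ring

/-- Cauchy–Schwarz on the diagonal, then adding the off-diagonal squares. The constant is what
produces the threshold `(d - 1) / d`. -/
theorem trace_sq_le {m : Type*} [Fintype m] (S : Matrix m m ℝ) :
    S.trace ^ 2 ≤ Fintype.card m * ∑ k, ∑ l, S k l ^ 2 := by
  refine (sq_sum_le_card_mul_sum_sq (s := Finset.univ) (f := fun k => S k k)).trans ?_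
  rw [Finset.card_univ]
  gcongr with k
  exact Finset.single_le_sum (f := fun l => S k l ^ 2) (fun l _ => sq_nonneg _)
    (Finset.mem_univ k)

/-- Factor `A⁻¹ = Cᵀ C` and take `S = C N diag(u) Nᵀ Cᵀ`; the quadratic form in `u` becomes a
Frobenius norm. Invertibility of `C` gives the last clause. -/
theorem exists_trace_eq_and_sum_sq_eq (N : Matrix m n ℝ) {A : Matrix m m ℝ} (hA : A.PosDef)
    (u : n → ℝ) : ∃ S : Matrix m m ℝ, S.trace = ∑ i, u i * (Nᵀ * A⁻¹ * N) i i ∧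
      ∑ k, ∑ l, S k l ^ 2 = ∑ i, ∑ j, u i * u j * (Nᵀ * A⁻¹ * N) i j ^ 2 ∧
      (S = 0 → weightedGram N u = 0) := by
  open scoped MatrixOrder in
  obtain ⟨C, hC, hAC⟩ :=
    CStarAlgebra.isStrictlyPositive_iff_eq_star_mul_self.mp hA.inv.isStrictlyPositive
  rw [star_eq_conjTranspose, conjTranspose_eq_transpose_of_trivial] at hAC
  have hQ : Nᵀ * A⁻¹ * N = (C * N)ᵀ * (C * N) := by
    rw [hAC, transpose_mul]; simp only [Matrix.mul_assoc]
  refine ⟨weightedGram (C * N) u, ?_, ?_, fun h => ?_⟩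
  · rw [hQ]
    simp only [trace, diag_apply, weightedGram_apply, mul_apply (M := (C * N)ᵀ), transpose_apply,
      Finset.mul_sum]
    exact Finset.sum_comm
  · rw [hQ]
    simp only [weightedGram_apply, mul_apply (M := (C * N)ᵀ), transpose_apply, sq,
      Finset.sum_mul, Finset.mul_sum]
    have swap (f : m → m → n → n → ℝ) :
        ∑ k, ∑ l, ∑ i, ∑ j, f k l i j = ∑ i, ∑ j, ∑ k, ∑ l, f k l i j := by
      rw [Finset.sum_congr rfl fun k _ => Finset.sum_comm, Finset.sum_comm]
      refine Finset.sum_congr rfl fun i _ => ?_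
      rw [Finset.sum_congr rfl fun k _ => Finset.sum_comm, Finset.sum_comm]
    rw [swap]
    refine Finset.sum_congr rfl fun i _ => Finset.sum_congr rfl fun j _ =>
      Finset.sum_congr rfl fun k _ => Finset.sum_congr rfl fun l _ => ?_
    ring
  · rw [weightedGram_mul_left] at h
    have hCt : IsUnit Cᵀ := by rwa [isUnit_transpose]
    rwa [hCt.mul_left_eq_zero, hC.mul_right_eq_zero] at h

end Matrix

noncomputable section

namespace Kirchhoff

open MvPolynomial Matrix

/-! ### Euler identities and the sign of the Hessian determinant. -/

section Homogeneous

variable {σ : Type*}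

theorem pderiv_comm (i j : σ) (F : MvPolynomial σ ℝ) :
    pderiv i (pderiv j F) = pderiv j (pderiv i F) :=
  LinearMap.congr_fun (pd_commute i j) F

theorem hessianAt_apply (F : MvPolynomial σ ℝ) (a : σ → ℝ) (i j : σ) :
    hessianAt F a i j = eval a (pderiv i (pderiv j F)) := rfl

theorem hessianAt_comm (F : MvPolynomial σ ℝ) (a : σ → ℝ) (i j : σ) :
    hessianAt F a i j = hessianAt F a j i := by
  rw [hessianAt_apply, pderiv_comm, hessianAt_apply]

theorem pderiv_eq_zero_of_isHomogeneous_zero {F : MvPolynomial σ ℝ} (hF : F.IsHomogeneous 0)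
    (i : σ) : pderiv i F = 0 := by
  rw [← totalDegree_zero_iff_isHomogeneous, totalDegree_eq_zero_iff_eq_C] at hF
  rw [hF, pderiv_C]

theorem eq_C_eval_of_isHomogeneous_zero {F : MvPolynomial σ ℝ} (hF : F.IsHomogeneous 0)
    (a : σ → ℝ) : F = C (eval a F) := by
  rw [← totalDegree_zero_iff_isHomogeneous, totalDegree_eq_zero_iff_eq_C] at hF
  rw [hF, eval_C]

variable [Fintype σ]

theorem eval_dirDeriv (a b : σ → ℝ) (F : MvPolynomial σ ℝ) :
    eval b (dirDeriv a F) = ∑ i, a i * eval b (pderiv i F) := by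
  simp [dirDeriv, smul_eval]

theorem isHomogeneous_dirDeriv (a : σ → ℝ) {F : MvPolynomial σ ℝ} {d : ℕ}
    (hF : F.IsHomogeneous d) : (dirDeriv a F).IsHomogeneous (d - 1) :=
  (homogeneousSubmodule σ ℝ (d - 1)).sum_mem fun i _ =>
    (homogeneousSubmodule σ ℝ (d - 1)).smul_mem _ (hF.pderiv (i := i))

theorem isHomogeneous_iterate_dirDeriv (a : σ → ℝ) {F : MvPolynomial σ ℝ} {d : ℕ}
    (hF : F.IsHomogeneous d) (l : ℕ) : ((dirDeriv a)^[l] F).IsHomogeneous (d - l) := by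
  induction l with
  | zero => exact hF
  | succ l ih =>
    rw [Function.iterate_succ_apply', ← Nat.sub_sub]
    exact isHomogeneous_dirDeriv a ih

theorem pderiv_dirDeriv (a : σ → ℝ) (i : σ) (F : MvPolynomial σ ℝ) :
    pderiv i (dirDeriv a F) = dirDeriv a (pderiv i F) := by
  simp only [dirDeriv, map_sum, Derivation.map_smul]
  exact Finset.sum_congr rfl fun j _ => by rw [pderiv_comm]

theorem pderiv_iterate_dirDeriv (a : σ → ℝ) (i : σ) (l : ℕ) (F : MvPolynomial σ ℝ) :
    pderiv i ((dirDeriv a)^[l] F) = (dirDeriv a)^[l] (pderiv i F) :=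
  Function.Semiconj.iterate_right (f := pderiv i) (pderiv_dirDeriv a i) l F

theorem eval_dirDeriv_self (a : σ → ℝ) {F : MvPolynomial σ ℝ} {d : ℕ}
    (hF : F.IsHomogeneous d) : eval a (dirDeriv a F) = d * eval a F := by
  have h := congrArg (eval a) hF.sum_X_mul_pderiv
  simpa [eval_dirDeriv] using h

/-- As the direction is also the point of evaluation, Euler's identity makes each derivative
multiply by the current degree. -/
theorem eval_iterate_dirDeriv_self (a : σ → ℝ) {F : MvPolynomial σ ℝ} {d : ℕ}
    (hF : F.IsHomogeneous d) (l : ℕ) :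
    eval a ((dirDeriv a)^[l] F) = d.descFactorial l * eval a F := by
  induction l with
  | zero => simp
  | succ l ih =>
    rw [Function.iterate_succ_apply',
      eval_dirDeriv_self a (isHomogeneous_iterate_dirDeriv a hF l), ih, Nat.descFactorial_succ]
    push_cast
    ring

theorem gradAt_iterate_dirDeriv (a : σ → ℝ) {F : MvPolynomial σ ℝ} {d : ℕ}
    (hF : F.IsHomogeneous d) (l : ℕ) (i : σ) :
    gradAt ((dirDeriv a)^[l] F) a i = (d - 1).descFactorial l * gradAt F a i := by
  rw [gradAt, pderiv_iterate_dirDeriv, eval_iterate_dirDeriv_self a hF.pderiv, gradAt]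

theorem hessianAt_iterate_dirDeriv (a : σ → ℝ) {F : MvPolynomial σ ℝ} {d : ℕ}
    (hF : F.IsHomogeneous d) (l : ℕ) (i j : σ) :
    hessianAt ((dirDeriv a)^[l] F) a i j = (d - 2).descFactorial l * hessianAt F a i j := by
  rw [hessianAt_apply, pderiv_iterate_dirDeriv, pderiv_iterate_dirDeriv,
    eval_iterate_dirDeriv_self a hF.pderiv.pderiv, hessianAt_apply, Nat.sub_sub]

theorem hessianAt_mulVec_self (a : σ → ℝ) {F : MvPolynomial σ ℝ} {d : ℕ}
    (hF : F.IsHomogeneous d) : hessianAt F a *ᵥ a = ((d - 1 : ℕ) : ℝ) • gradAt F a := by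
  ext i
  rw [Pi.smul_apply, smul_eq_mul, gradAt, ← eval_dirDeriv_self a hF.pderiv, eval_dirDeriv]
  exact Finset.sum_congr rfl fun j _ =>
    (congrArg (· * a j) (hessianAt_comm F a i j)).trans (mul_comm _ _)

theorem gradAt_dotProduct_self (a : σ → ℝ) {F : MvPolynomial σ ℝ} {d : ℕ}
    (hF : F.IsHomogeneous d) : gradAt F a ⬝ᵥ a = d * eval a F := by
  rw [← eval_dirDeriv_self a hF, eval_dirDeriv]
  exact Finset.sum_congr rfl fun j _ => by rw [gradAt, mul_comm]

/-- The Hessian of a strictly homogeneous log-concave polynomial of degree at least two is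
nondegenerate, and its determinant has the sign of that of a form of signature `(+, -, …, -)`. -/
theorem StrictlyHomogeneousLogConcaveAt.det_hessian_pos [DecidableEq σ] {F : MvPolynomial σ ℝ}
    {d : ℕ} {a : σ → ℝ} (h : StrictlyHomogeneousLogConcaveAt F d a) (hd : 2 ≤ d)
    (ha : 0 < eval a F) (hn : 0 < Fintype.card σ) :
    0 < (-1 : ℝ) ^ (Fintype.card σ - 1) * eval a (hessian F).det := by
  have hd' : (2 : ℝ) ≤ d := by exact_mod_cast hd
  have hdet : eval a (hessian F).det = (hessianAt F a).det := by
    rw [RingHom.map_det]; rfl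
  have hP := h.2 1 (by rw [div_lt_one (by linarith)]; linarith)
  rw [one_smul] at hP
  set g := gradAt F a with hg
  set H := hessianAt F a with hH
  set P := -(eval a F • H) + vecMulVec g g with hPdef
  have hPa : P *ᵥ a = eval a F • g := by
    rw [hPdef, add_mulVec, neg_mulVec, smul_mulVec, hessianAt_mulVec_self a h.1,
      vecMulVec_mulVec, gradAt_dotProduct_self a h.1]
    ext i
    simp only [Pi.add_apply, Pi.neg_apply, Pi.smul_apply, smul_eq_mul, MulOpposite.op_mul,
      MulOpposite.smul_eq_mul_unop, MulOpposite.unop_mul, MulOpposite.unop_op]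
    push_cast [Nat.cast_sub (by omega : 1 ≤ d)]
    ring
  -- Since `P a = F(a) g`, the rank one term `g gᵀ` equals `P` times `F(a)⁻¹ a gᵀ`.
  have hfac : -(eval a F • H) = P * (1 - vecMulVec ((eval a F)⁻¹ • a) g) := by
    rw [Matrix.mul_sub, Matrix.mul_one, mul_vecMulVec, mulVec_smul, hPa, smul_smul,
      inv_mul_cancel₀ ha.ne', one_smul, hPdef, add_sub_cancel_right]
  -- By Euler `gᵀ a = d F(a)`; the negative factor `1 - d` accounts for the single positive
  -- direction of the Hessian.
  have hdet1 : (1 - vecMulVec ((eval a F)⁻¹ • a) g).det = 1 - d := by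
    rw [vecMulVec_eq Unit, det_one_sub_mul_comm, det_unique]
    have := gradAt_dotProduct_self a h.1
    change 1 - g ⬝ᵥ ((eval a F)⁻¹ • a) = 1 - (d : ℝ)
    rw [dotProduct_smul, this, smul_eq_mul]
    field_simp
  have hmain := congrArg Matrix.det hfac
  rw [det_mul, hdet1, ← neg_smul, det_smul, neg_pow] at hmain
  rw [hdet]
  have hpow : (-1 : ℝ) ^ Fintype.card σ = -(-1) ^ (Fintype.card σ - 1) := by
    conv_lhs => rw [← Nat.sub_add_cancel hn, pow_succ]
    ring
  rw [hpow] at hmain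
  have h1 : 0 < P.det * ((d : ℝ) - 1) := mul_pos hP.det_pos (by linarith)
  have h2 : P.det * ((d : ℝ) - 1) =
      eval a F ^ Fintype.card σ * ((-1) ^ (Fintype.card σ - 1) * H.det) := by
    linear_combination hmain
  rw [h2] at h1
  exact pos_of_mul_pos_right h1 (pow_pos ha _).le

end Homogeneous

/-! ### The annihilator algebra and the Lefschetz property. -/

section Lefschetz

variable {σ : Type*} [Fintype σ]

theorem diffOp_linForm (a : σ → ℝ) (F : MvPolynomial σ ℝ) :
    diffOp (linForm a) F = dirDeriv a F := by
  simp [linForm, dirDeriv, map_sum, diffOp_X]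

theorem diffOp_linForm_pow (a : σ → ℝ) (k : ℕ) (F : MvPolynomial σ ℝ) :
    diffOp (linForm a ^ k) F = (dirDeriv a)^[k] F := by
  induction k with
  | zero => simp
  | succ k ih =>
    rw [pow_succ', map_mul, Module.End.mul_apply, ih, diffOp_linForm,
      Function.iterate_succ_apply']

theorem isHomogeneous_linForm (a : σ → ℝ) : (linForm a).IsHomogeneous 1 :=
  (homogeneousSubmodule σ ℝ 1).sum_mem fun i _ =>
    (homogeneousSubmodule σ ℝ 1).smul_mem _ (isHomogeneous_X ℝ i)

theorem exists_eq_linForm {P : MvPolynomial σ ℝ} (hP : P.IsHomogeneous 1) :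
    ∃ p, P = linForm p := by
  refine ⟨fun i => eval 0 (pderiv i P), ?_⟩
  conv_lhs => rw [← one_smul ℕ P, ← hP.sum_X_mul_pderiv]
  refine Finset.sum_congr rfl fun i _ => ?_
  conv_lhs => rw [eq_C_eval_of_isHomogeneous_zero (hP.pderiv (i := i)) 0]
  rw [mul_comm, C_mul']

/-- The vanishing clause is needed separately: `d - m.degree` truncates to 0 when too many
derivatives are taken. -/
theorem monomialDiff_isHomogeneous (m : σ →₀ ℕ) :
    ∀ {F : MvPolynomial σ ℝ} {d : ℕ}, F.IsHomogeneous d →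
      (monomialDiff m F).IsHomogeneous (d - m.degree) ∧
        (d < m.degree → monomialDiff m F = 0) := by
  have hone (i : σ) (F : MvPolynomial σ ℝ) :
      monomialDiff (Finsupp.single i 1) F = pderiv i F := by
    rw [← diffOp_X, X, diffOp_monomial, one_smul]
  have hadd (m m' : σ →₀ ℕ)
      (hm : ∀ {F : MvPolynomial σ ℝ} {d : ℕ}, F.IsHomogeneous d →
        (monomialDiff m F).IsHomogeneous (d - m.degree) ∧
          (d < m.degree → monomialDiff m F = 0))
      (hm' : ∀ {F : MvPolynomial σ ℝ} {d : ℕ}, F.IsHomogeneous d →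
        (monomialDiff m' F).IsHomogeneous (d - m'.degree) ∧
          (d < m'.degree → monomialDiff m' F = 0))
      {F : MvPolynomial σ ℝ} {d : ℕ} (hF : F.IsHomogeneous d) :
      (monomialDiff (m + m') F).IsHomogeneous (d - (m + m').degree) ∧
        (d < (m + m').degree → monomialDiff (m + m') F = 0) := by
    rw [monomialDiff_add, Module.End.mul_apply, map_add, add_comm m.degree, ← Nat.sub_sub]
    refine ⟨(hm (hm' hF).1).1, fun h => ?_⟩
    by_cases h' : d < m'.degree
    · rw [(hm' hF).2 h', map_zero]
    · exact (hm (hm' hF).1).2 (by omega)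
  induction m using Finsupp.induction_linear with
  | zero =>
    intro F d hF
    rw [monomialDiff_zero]
    simpa using hF
  | add m m' hm hm' => exact hadd m m' hm hm'
  | single i n =>
    induction n with
    | zero =>
      intro F d hF
      rw [Finsupp.single_zero, monomialDiff_zero]
      simpa using hF
    | succ n ih =>
      rw [Finsupp.single_add]
      intro F d hF
      refine hadd _ _ ih (fun {F d} hF => ?_) hF
      rw [hone, Finsupp.degree_single]
      refine ⟨hF.pderiv, fun h => pderiv_eq_zero_of_isHomogeneous_zero ?_ i⟩
      rwa [Nat.lt_one_iff.1 h] at hF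

theorem isHomogeneous_diffOp {P F : MvPolynomial σ ℝ} {k d : ℕ} (hP : P.IsHomogeneous k)
    (hF : F.IsHomogeneous d) : (diffOp P F).IsHomogeneous (d - k) := by
  rw [P.as_sum, map_sum, LinearMap.sum_apply]
  refine IsHomogeneous.sum _ _ _ fun m hm => ?_
  have hdeg : m.degree = k := (hP.degree_eq_sum_deg_support hm).symm
  rw [diffOp_monomial, ← hdeg]
  exact (homogeneousSubmodule σ ℝ _).smul_mem _ (monomialDiff_isHomogeneous m hF).1

theorem diffOp_eq_zero {P F : MvPolynomial σ ℝ} {k d : ℕ} (hP : P.IsHomogeneous k)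
    (hF : F.IsHomogeneous d) (h : d < k) : diffOp P F = 0 := by
  rw [P.as_sum, map_sum, LinearMap.sum_apply]
  refine Finset.sum_eq_zero fun m hm => ?_
  have hdeg : m.degree = k := (hP.degree_eq_sum_deg_support hm).symm
  rw [diffOp_monomial, LinearMap.smul_apply,
    (monomialDiff_isHomogeneous m hF).2 (hdeg ▸ h), smul_zero]

theorem mem_ann {F P : MvPolynomial σ ℝ} : P ∈ ann F ↔ diffOp P F = 0 := Iff.rfl

theorem mk_mem_annAlgebraPiece (F : MvPolynomial σ ℝ) {P : MvPolynomial σ ℝ} {k : ℕ}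
    (hP : P.IsHomogeneous k) : Ideal.Quotient.mk (ann F) P ∈ annAlgebraPiece F k :=
  ⟨P, hP, rfl⟩

theorem mem_annAlgebraPiece {F : MvPolynomial σ ℝ} {x : annAlgebra F} {k : ℕ} :
    x ∈ annAlgebraPiece F k ↔ ∃ P, P.IsHomogeneous k ∧ Ideal.Quotient.mk (ann F) P = x :=
  Iff.rfl

/-- Link between the algebra and the Hessian: for `2 ≤ d` the operator leaves a linear form, and its
coefficients are read off here. -/
theorem eval_pderiv_diffOp_linForm (a p : σ → ℝ) {F : MvPolynomial σ ℝ} {d : ℕ}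
    (hF : F.IsHomogeneous d) (j : σ) :
    eval a (pderiv j (diffOp (linForm a ^ (d - 2) * linForm p) F)) =
      (d - 2).factorial * (hessianAt F a *ᵥ p) j := by
  rw [map_mul, Module.End.mul_apply, diffOp_linForm, diffOp_linForm_pow, pderiv_iterate_dirDeriv,
    eval_iterate_dirDeriv_self a (d := d - 2), Nat.descFactorial_self, pderiv_dirDeriv,
    eval_dirDeriv]
  · congr 1
    exact Finset.sum_congr rfl fun i _ =>
      (mul_comm _ _).trans (congrArg (· * p i) (hessianAt_comm F a i j))
  · exact (isHomogeneous_dirDeriv p hF).pderiv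

/-- A homogeneous form whose Hessian does not vanish at `a` has the strong Lefschetz property in
degree one with respect to the linear form of `a`. -/
theorem hasStrongLefschetzAt_one [DecidableEq σ] {F : MvPolynomial σ ℝ} {d : ℕ} {a : σ → ℝ}
    (hF : F.IsHomogeneous d) (hd : 2 ≤ d) (ha : eval a F ≠ 0) (hH : (hessianAt F a).det ≠ 0) :
    HasStrongLefschetzAt (annAlgebraPiece F) d (Ideal.Quotient.mk (ann F) (linForm a)) 1 where
  mem_one := mk_mem_annAlgebraPiece F (isHomogeneous_linForm a)
  top_ne_bot := by
    intro hbot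
    have hmem : Ideal.Quotient.mk (ann F) (linForm a ^ d) ∈ annAlgebraPiece F d :=
      mk_mem_annAlgebraPiece F (by simpa using (isHomogeneous_linForm a).pow d)
    rw [hbot, Submodule.mem_bot, Ideal.Quotient.eq_zero_iff_mem, mem_ann,
      diffOp_linForm_pow] at hmem
    have := eval_iterate_dirDeriv_self a hF d
    rw [hmem, map_zero, Nat.descFactorial_self] at this
    exact mul_ne_zero (Nat.cast_ne_zero.2 d.factorial_ne_zero) ha this.symm
  above_eq_bot i hi := by
    rw [eq_bot_iff]
    rintro _ ⟨P, hP, rfl⟩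
    exact Ideal.Quotient.eq_zero_iff_mem.2 (diffOp_eq_zero hP hF hi)
  two_mul_le := by omega
  bijOn := by
    have hlin (p : σ → ℝ) : (linForm a ^ (d - 2) * linForm p).IsHomogeneous (d - 1) := by
      have := ((isHomogeneous_linForm a).pow (d - 2)).mul (isHomogeneous_linForm p)
      rwa [one_mul, show d - 2 + 1 = d - 1 by omega] at this
    have hfac : ((d - 2).factorial : ℝ) ≠ 0 := Nat.cast_ne_zero.2 (Nat.factorial_ne_zero _)
    rw [mul_one]
    refine ⟨?_, ?_, ?_⟩
    · rintro _ ⟨P, hP, rfl⟩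
      obtain ⟨p, rfl⟩ := exists_eq_linForm hP
      exact mk_mem_annAlgebraPiece F (hlin p)
    · intro x hx y hy hxy
      obtain ⟨P, hP, hPxy⟩ := mem_annAlgebraPiece.1 (sub_mem hx hy)
      obtain ⟨p, rfl⟩ := exists_eq_linForm hP
      have h0 : linForm a ^ (d - 2) * linForm p ∈ ann F := by
        rw [← Ideal.Quotient.eq_zero_iff_mem, map_mul, map_pow, hPxy, mul_sub, sub_eq_zero]
        exact hxy
      have hp : hessianAt F a *ᵥ p = 0 := by
        ext j
        have := eval_pderiv_diffOp_linForm a p hF j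
        rw [mem_ann.1 h0, map_zero, map_zero] at this
        exact (mul_eq_zero.1 this.symm).resolve_left hfac
      rw [eq_zero_of_mulVec_eq_zero hH hp] at hPxy
      rw [← sub_eq_zero, ← hPxy]
      simp [linForm]
    · intro y hy
      obtain ⟨Q, hQ, rfl⟩ := mem_annAlgebraPiece.1 hy
      -- Solve `(d-2)! H p = ∇(Q(∂)F)`. Both sides applied to `F` are linear forms, so equal
      -- gradients make them equal.
      let v : σ → ℝ := fun j => ((d - 2).factorial : ℝ)⁻¹ * eval a (pderiv j (diffOp Q F))
      let p := (hessianAt F a)⁻¹ *ᵥ v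
      have hp : hessianAt F a *ᵥ p = v := by
        rw [mulVec_mulVec, mul_nonsing_inv _ hH.isUnit, one_mulVec]
      refine ⟨Ideal.Quotient.mk (ann F) (linForm p),
        mk_mem_annAlgebraPiece F (isHomogeneous_linForm p), ?_⟩
      change Ideal.Quotient.mk (ann F) (linForm a) ^ (d - 2) * _ = _
      rw [← map_pow, ← map_mul, Ideal.Quotient.mk_eq_mk_iff_sub_mem, mem_ann]
      have hG : (diffOp (linForm a ^ (d - 2) * linForm p - Q) F).IsHomogeneous 1 := by
        have := isHomogeneous_diffOp ((hlin p).sub hQ) hF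
        rwa [show d - (d - 1) = 1 by omega] at this
      rw [← one_smul ℕ (diffOp _ F), ← hG.sum_X_mul_pderiv]
      refine Finset.sum_eq_zero fun j _ => ?_
      rw [eq_C_eval_of_isHomogeneous_zero (hG.pderiv (i := j)) a, map_sub, LinearMap.sub_apply,
        map_sub, map_sub, eval_pderiv_diffOp_linForm a p hF, hp, mul_inv_cancel_left₀ hfac,
        sub_self, C_0, mul_zero]

end Lefschetz

/-! ### Multiaffine polynomials and finite differences. -/

section Multiaffine

variable {σ : Type*} [DecidableEq σ]

/-- The polynomials of degree at most one in every variable. -/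
def multiaffine (σ : Type*) : Submodule ℝ (MvPolynomial σ ℝ) :=
  Submodule.span ℝ (Set.range fun T : Finset σ => ∏ e ∈ T, X e)

theorem pderiv_prod_X (i : σ) (T : Finset σ) :
    pderiv i (∏ e ∈ T, X e : MvPolynomial σ ℝ) =
      if i ∈ T then ∏ e ∈ T.erase i, X e else 0 := by
  have h0 (S : Finset σ) (hS : i ∉ S) : pderiv i (∏ e ∈ S, X e : MvPolynomial σ ℝ) = 0 := by
    induction S using Finset.induction_on with
    | empty => simp
    | insert e S he ih =>
      rw [Finset.mem_insert, not_or] at hS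
      rw [Finset.prod_insert he, pderiv_mul, ih hS.2, pderiv_X_of_ne (Ne.symm hS.1)]
      simp
  split_ifs with hi
  · rw [← Finset.mul_prod_erase T _ hi, pderiv_mul, h0 _ (Finset.notMem_erase i T), pderiv_X_self]
    simp
  · exact h0 T hi

theorem pderiv_mem_multiaffine (i : σ) {F : MvPolynomial σ ℝ} (hF : F ∈ multiaffine σ) :
    pderiv i F ∈ multiaffine σ := by
  induction hF using Submodule.span_induction with
  | mem _ h =>
    obtain ⟨T, rfl⟩ := h
    dsimp only
    rw [pderiv_prod_X]
    split_ifs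
    · exact Submodule.subset_span ⟨_, rfl⟩
    · exact zero_mem _
  | zero => rw [map_zero]; exact zero_mem _
  | add _ _ _ _ h1 h2 => rw [map_add]; exact add_mem h1 h2
  | smul c _ _ h => rw [Derivation.map_smul]; exact Submodule.smul_mem _ c h

/-- An affine function of one variable has slope equal to its unit difference, so derivatives can be
read from determinants without differentiating them. -/
theorem eval_pderiv_of_mem_multiaffine (i : σ) {F : MvPolynomial σ ℝ} (hF : F ∈ multiaffine σ)
    (a : σ → ℝ) : eval a (pderiv i F) = eval (a + Pi.single i 1) F - eval a F := by
  induction hF using Submodule.span_induction with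
  | mem _ h =>
    obtain ⟨T, rfl⟩ := h
    dsimp only
    rw [pderiv_prod_X, map_prod, map_prod]
    have h0 (S : Finset σ) (hS : i ∉ S) : ∏ e ∈ S, eval (a + Pi.single i 1) (X e : MvPolynomial σ ℝ)
        = ∏ e ∈ S, eval a (X e : MvPolynomial σ ℝ) := by
      refine Finset.prod_congr rfl fun e he => ?_
      have : e ≠ i := fun h => hS (h ▸ he)
      simp [this]
    split_ifs with hi
    · rw [← Finset.mul_prod_erase T _ hi, ← Finset.mul_prod_erase T _ hi,
        h0 _ (Finset.notMem_erase i T), map_prod]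
      simp
      ring
    · rw [h0 T hi]; simp
  | zero => simp
  | add _ _ _ _ h1 h2 => rw [map_add, map_add, map_add, map_add, h1, h2]; ring
  | smul c _ _ h => rw [Derivation.map_smul, smul_eval, smul_eval, smul_eval, h]; ring

theorem hessianAt_of_mem_multiaffine {F : MvPolynomial σ ℝ} (hF : F ∈ multiaffine σ)
    (a : σ → ℝ) (i j : σ) : hessianAt F a i j =
      eval (a + Pi.single i 1 + Pi.single j 1) F - eval (a + Pi.single i 1) F -
        (eval (a + Pi.single j 1) F - eval a F) := by
  rw [hessianAt_apply, eval_pderiv_of_mem_multiaffine i (pderiv_mem_multiaffine j hF),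
    eval_pderiv_of_mem_multiaffine j hF, eval_pderiv_of_mem_multiaffine j hF]

end Multiaffine

end Kirchhoff

noncomputable section

namespace Kirchhoff

open MvPolynomial Matrix

/-! ### Log-concavity of the Kirchhoff polynomial and its derivatives. -/

section Graphs

variable {V : Type*} [Fintype V] [DecidableEq V] {G : SimpleGraph V} [DecidableRel G.Adj] (v₀ : V)

omit [DecidableEq V] in
theorem kirchhoffPoly_mem_multiaffine : kirchhoffPoly G ∈ multiaffine G.edgeSet :=
  Submodule.sum_mem _ fun T _ => Submodule.subset_span ⟨T, rfl⟩

/-- Semidefiniteness is formal; definiteness follows because the determinant is a positive sum over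
spanning trees. -/
theorem posDef_weightedGram (hG : G.Connected) {a : G.edgeSet → ℝ} (ha : ∀ e, 0 < a e) :
    (weightedGram (realIncidence G v₀) a).PosDef := by
  have hsd : (weightedGram (realIncidence G v₀) a).PosSemidef := by
    have := (PosSemidef.diagonal fun e => (ha e).le).mul_mul_conjTranspose_same
      (realIncidence G v₀)
    rwa [conjTranspose_eq_transpose_of_trivial] at this
  rw [hsd.posDef_iff_det_ne_zero, ← eval_kirchhoffPoly]
  exact (eval_kirchhoffPoly_pos hG ha).ne'

/-- The transfer matrix `Nᵀ L⁻¹ N` of the weighted graph, where `L` is the reduced Laplacian. -/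
def transfer (G : SimpleGraph V) [DecidableRel G.Adj] (v₀ : V) (a : G.edgeSet → ℝ) :
    Matrix G.edgeSet G.edgeSet ℝ :=
  (realIncidence G v₀)ᵀ * (weightedGram (realIncidence G v₀) a)⁻¹ * realIncidence G v₀

theorem gradAt_kirchhoffPoly (hG : G.Connected) {a : G.edgeSet → ℝ} (ha : ∀ e, 0 < a e)
    (i : G.edgeSet) :
    gradAt (kirchhoffPoly G) a i = eval a (kirchhoffPoly G) * transfer G v₀ a i i := by
  rw [gradAt, eval_pderiv_of_mem_multiaffine i kirchhoffPoly_mem_multiaffine,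
    eval_kirchhoffPoly G v₀, eval_kirchhoffPoly G v₀,
    det_weightedGram_add_single_one _ _ (posDef_weightedGram v₀ hG ha).det_pos.ne'.isUnit,
    transfer]
  ring

theorem hessianAt_kirchhoffPoly (hG : G.Connected) {a : G.edgeSet → ℝ} (ha : ∀ e, 0 < a e)
    (i j : G.edgeSet) :
    hessianAt (kirchhoffPoly G) a i j = eval a (kirchhoffPoly G) *
      (transfer G v₀ a i i * transfer G v₀ a j j - transfer G v₀ a i j ^ 2) := by
  have hA := posDef_weightedGram v₀ hG ha
  rw [hessianAt_of_mem_multiaffine kirchhoffPoly_mem_multiaffine, eval_kirchhoffPoly G v₀,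
    eval_kirchhoffPoly G v₀, eval_kirchhoffPoly G v₀, eval_kirchhoffPoly G v₀,
    det_weightedGram_add_single_one _ _ hA.det_pos.ne'.isUnit,
    det_weightedGram_add_single_one _ _ hA.det_pos.ne'.isUnit,
    det_weightedGram_add_single_two _ _ hA, transfer]
  ring

theorem transfer_sq_sum (hG : G.Connected) {a : G.edgeSet → ℝ} (ha : ∀ e, 0 < a e) {r : ℕ}
    (hV : Fintype.card V = r + 1) {u : G.edgeSet → ℝ} (hu : u ≠ 0) :
    0 < ∑ i, ∑ j, u i * u j * transfer G v₀ a i j ^ 2 ∧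
      (∑ i, u i * transfer G v₀ a i i) ^ 2 ≤
        r * ∑ i, ∑ j, u i * u j * transfer G v₀ a i j ^ 2 := by
  obtain ⟨S, htr, hsq, h0⟩ :=
    exists_trace_eq_and_sum_sq_eq (realIncidence G v₀) (posDef_weightedGram v₀ hG ha) u
  have hcard : Fintype.card {v : V // v ≠ v₀} = r := by
    rw [Fintype.card_subtype_compl, Fintype.card_subtype_eq]; omega
  have hle := trace_sq_le S
  rw [htr, hsq, hcard] at hle
  refine ⟨lt_of_le_of_ne ?_ fun h => hu ?_, hle⟩
  · exact hsq ▸ Finset.sum_nonneg fun k _ => Finset.sum_nonneg fun l _ => sq_nonneg _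
  · refine eq_zero_of_weightedGram_eq_zero v₀ u (h0 ?_)
    have hS := hsq.trans h.symm
    replace hS := (Finset.sum_eq_zero_iff_of_nonneg
      fun k _ => Finset.sum_nonneg fun l _ => sq_nonneg (S k l)).1 hS
    ext k l
    have := (Finset.sum_eq_zero_iff_of_nonneg fun l _ => sq_nonneg _).1
      (hS k (Finset.mem_univ k)) l (Finset.mem_univ l)
    exact pow_eq_zero_iff two_ne_zero |>.1 this

/-- Repeated derivatives of the Kirchhoff polynomial of a connected simple graph in a positive
direction are strictly homogeneous log-concave at the vector of that direction. -/
theorem strictlyHomogeneousLogConcaveAt_iterate_dirDeriv (hG : G.Connected)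
    {a : G.edgeSet → ℝ} (ha : ∀ e, 0 < a e) {r l : ℕ} (hV : Fintype.card V = r + 1)
    (hl : l + 2 ≤ r) :
    StrictlyHomogeneousLogConcaveAt ((dirDeriv a)^[l] (kirchhoffPoly G)) (r - l) a := by
  obtain ⟨v₀⟩ := hG.nonempty
  have hhom := isHomogeneous_kirchhoffPoly (G := G) hV
  refine ⟨isHomogeneous_iterate_dirDeriv a hhom l, fun s hs => ?_⟩
  set F := (dirDeriv a)^[l] (kirchhoffPoly G) with hF
  refine PosDef.of_dotProduct_mulVec_pos ?_ fun u hu => ?_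
  · ext i j
    simp only [conjTranspose_apply, Matrix.add_apply, Matrix.neg_apply, Matrix.smul_apply,
      vecMulVec_apply, star_trivial, hessianAt_comm F a i j, mul_comm (gradAt F a i)]
  have hf := eval_kirchhoffPoly_pos hG ha
  set f := eval a (kirchhoffPoly G) with hfdef
  obtain ⟨hq, htq⟩ := transfer_sq_sum v₀ hG ha hV hu
  set q := ∑ i, ∑ j, u i * u j * transfer G v₀ a i j ^ 2 with hqdef
  set t := ∑ i, u i * transfer G v₀ a i i with htdef
  set c₀ := (r.descFactorial l : ℝ) with hc₀
  set c₁ := ((r - 1).descFactorial l : ℝ) with hc₁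
  set c₂ := ((r - 2).descFactorial l : ℝ) with hc₂
  have hform : star u ⬝ᵥ ((-(eval a F • hessianAt F a) +
      s • vecMulVec (gradAt F a) (gradAt F a)) *ᵥ u) =
      f ^ 2 * (c₀ * c₂ * q + (s * c₁ ^ 2 - c₀ * c₂) * t ^ 2) := by
    have ht2 : t ^ 2 = ∑ i, ∑ j, u i * u j * (transfer G v₀ a i i * transfer G v₀ a j j) := by
      rw [sq, htdef, Finset.sum_mul_sum]
      exact Finset.sum_congr rfl fun i _ => Finset.sum_congr rfl fun j _ => by ring
    rw [ht2, hqdef, Finset.mul_sum, Finset.mul_sum, ← Finset.sum_add_distrib, Finset.mul_sum]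
    refine Finset.sum_congr rfl fun i _ => ?_
    rw [mulVec, dotProduct, Finset.mul_sum, Finset.mul_sum, Finset.mul_sum,
      ← Finset.sum_add_distrib, Finset.mul_sum]
    refine Finset.sum_congr rfl fun j _ => ?_
    rw [Matrix.add_apply, Matrix.neg_apply, Matrix.smul_apply, Matrix.smul_apply, vecMulVec_apply,
      hF, eval_iterate_dirDeriv_self a hhom, gradAt_iterate_dirDeriv a hhom,
      gradAt_iterate_dirDeriv a hhom, hessianAt_iterate_dirDeriv a hhom,
      gradAt_kirchhoffPoly v₀ hG ha, gradAt_kirchhoffPoly v₀ hG ha,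
      hessianAt_kirchhoffPoly v₀ hG ha]
    simp only [Pi.star_apply, star_trivial, smul_eq_mul, ← hc₀, ← hc₁, ← hc₂, ← hfdef]
    ring
  rw [hform]
  refine mul_pos (pow_pos hf 2) ?_
  have hc₀p : 0 < c₀ := Nat.cast_pos.2 (Nat.descFactorial_pos.2 (by omega))
  have hc₁p : 0 < c₁ := Nat.cast_pos.2 (Nat.descFactorial_pos.2 (by omega))
  have hc₂p : 0 < c₂ := Nat.cast_pos.2 (Nat.descFactorial_pos.2 (by omega))
  -- The falling factorial of `k + 1` of length `l + 1` loses either its last or its first factor.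
  have hdesc (k : ℕ) : (k + 1 - l) * (k + 1).descFactorial l = (k + 1) * k.descFactorial l := by
    rw [← Nat.descFactorial_succ, Nat.succ_descFactorial_succ]
  have hr : (2 : ℝ) + l ≤ r := by exact_mod_cast (by omega : 2 + l ≤ r)
  have hl0 : (0 : ℝ) ≤ l := Nat.cast_nonneg l
  have h01 : ((r : ℝ) - l) * c₀ = r * c₁ := by
    have := hdesc (r - 1)
    rw [show r - 1 + 1 = r by omega] at this
    have := congrArg (Nat.cast (R := ℝ)) this
    push_cast [Nat.cast_sub (by omega : l ≤ r)] at this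
    exact this
  have h12 : ((r : ℝ) - 1 - l) * c₁ = (r - 1) * c₂ := by
    have := hdesc (r - 2)
    rw [show r - 2 + 1 = r - 1 by omega] at this
    have := congrArg (Nat.cast (R := ℝ)) this
    push_cast [Nat.cast_sub (by omega : l ≤ r - 1), Nat.cast_sub (by omega : 1 ≤ r)] at this
    exact this
  have hprod : 0 < c₀ * c₂ := mul_pos hc₀p hc₂p
  -- This converts the degree `r` bound `t² ≤ r q` into the threshold `(d - 1) / d` for degree `d =
  -- r - l`.
  have hcoef : c₀ * c₂ * ((r : ℝ) - 1) = c₁ ^ 2 * (r * (((r : ℝ) - l - 1) / (r - l))) := by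
    have hne : (r : ℝ) - l ≠ 0 := by linarith
    field_simp
    linear_combination (-(r - 1) * c₂) * h01 * (-1) + (-(r * c₁)) * h12
  have hs' : 0 < s - ((r : ℝ) - l - 1) / (r - l) := by
    rw [Nat.cast_sub (by omega : l ≤ r)] at hs
    linarith
  -- If `t = 0` then `q > 0` suffices. Otherwise `r` times the form is a Cauchy–Schwarz defect plus
  -- a positive multiple of `(s - (d - 1) / d) t²`.
  by_cases ht : t = 0
  · rw [ht]
    have := mul_pos hprod hq
    simpa using this
  · have ht2 : 0 < t ^ 2 := by positivity
    have hr0 : (0 : ℝ) < r := by linarith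
    have h1 : 0 ≤ c₀ * c₂ * (r * q - t ^ 2) := mul_nonneg hprod.le (by linarith)
    have h2 : 0 < r * (c₁ ^ 2 * (s - ((r : ℝ) - l - 1) / (r - l))) * t ^ 2 := by positivity
    refine pos_of_mul_pos_right (a := (r : ℝ)) ?_ hr0.le
    have : (r : ℝ) * (c₀ * c₂ * q + (s * c₁ ^ 2 - c₀ * c₂) * t ^ 2) =
        c₀ * c₂ * (r * q - t ^ 2) +
          r * (c₁ ^ 2 * (s - ((r : ℝ) - l - 1) / (r - l))) * t ^ 2 := by
      linear_combination (-t ^ 2) * hcoef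
    rw [this]
    exact add_pos_of_nonneg_of_pos h1 h2

end Graphs

end Kirchhoff

end

theorem corollary5p13 {V : Type*} [Fintype V] [DecidableEq V] (Γ : SimpleGraph V)
    [DecidableRel Γ.Adj] (hconn : Γ.Connected) (r n : ℕ)
    (hV : Fintype.card V = r + 1) (hV3 : 3 ≤ r + 1)
    (hE : Fintype.card Γ.edgeSet = n) (hE3 : 3 ≤ n)
    (l : ℕ) (hl : l ≤ r - 2)
    (a : Γ.edgeSet → ℝ) (ha : ∀ e, 0 < a e) :
    let F : MvPolynomial Γ.edgeSet ℝ := (Kirchhoff.dirDeriv a)^[l] (Kirchhoff.kirchhoffPoly Γ)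
    Kirchhoff.StrictlyHomogeneousLogConcaveAt F (r - l) a ∧
      0 < (-1 : ℝ) ^ (n - 1) * MvPolynomial.eval a (Kirchhoff.hessian F).det ∧
      Kirchhoff.HasStrongLefschetzAt (Kirchhoff.annAlgebraPiece F) (r - l)
        (Ideal.Quotient.mk (Kirchhoff.ann F) (Kirchhoff.linForm a)) 1 := by
  intro F
  have hslc := Kirchhoff.strictlyHomogeneousLogConcaveAt_iterate_dirDeriv hconn ha hV
    (by omega : l + 2 ≤ r)
  have hFa : 0 < MvPolynomial.eval a F := by
    rw [Kirchhoff.eval_iterate_dirDeriv_self a (Kirchhoff.isHomogeneous_kirchhoffPoly hV)]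
    exact mul_pos (Nat.cast_pos.2 (Nat.descFactorial_pos.2 (by omega)))
      (Kirchhoff.eval_kirchhoffPoly_pos hconn ha)
  have hdet := hslc.det_hessian_pos (by omega) hFa (by omega)
  rw [hE] at hdet
  refine ⟨hslc, hdet, Kirchhoff.hasStrongLefschetzAt_one hslc.1 (by omega) hFa.ne' fun h0 => ?_⟩
  have h1 : MvPolynomial.eval a (Kirchhoff.hessian F).det = (Kirchhoff.hessianAt F a).det :=
    RingHom.map_det _ _
  rw [h1, h0, mul_zero] at hdet
  exact hdet.false
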